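/- For a positive integer $n$ let $P_n$ be the path with vertex set $\{1,\ldots,n\}$ and edges $\{i,i+1\}$, $1\le i\le n-1$. A partial automorphism of $P_n$ is an injective partial map $\alpha$ from $\{1,\ldots,n\}$ to itself such that, for all $u,v$ in the domain of $\alpha$, $\{u,v\}$ is an edge of $P_n$ if and only if $\{u\alpha,v\alpha\}$ is an edge of $P_n$. Let $\mathrm{PAut}(P_n)$ be the monoid of all partial automorphisms of $P_n$ under composition of partial maps, and let the rank of a monoid be the least cardinality of a set that generates it as a monoid. Then the rank of $\mathrm{PAut}(P_3)$ is equal to $3$ and, for every $n\ge 4$, the rank of $\mathrm{PAut}(P_n)$ is equal to $n-1$. -/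

import Mathlib

/-- Partial permutations of `V` (the symmetric inverse monoid on `V`), under composition of
partial maps. Maps are written on the right of their arguments, so that `f * g` is
"first `f`, then `g`", with the largest domain on which this makes sense. -/
instance PEquiv.instMonoidSelf {V : Type*} : Monoid (V ≃. V) where
  mul f g := f.trans g
  one := PEquiv.refl V
  mul_assoc f g h := PEquiv.trans_assoc f g h
  one_mul f := PEquiv.refl_trans f
  mul_one f := PEquiv.trans_refl f

namespace SimpleGraph

/-- A partial transformation `f` of the vertex set (`f u = none` when `u` is outside the domain)
is a partial endomorphism of `G` if it maps edges inside its domain to edges. -/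
def IsPartialEndomorphism {V : Type*} (G : SimpleGraph V) (f : V → Option V) : Prop :=
  ∀ ⦃u v x y : V⦄, f u = some x → f v = some y → G.Adj u v → G.Adj x y

/-- The monoid of partial automorphisms of `G`: the partial permutations `f` of the vertex set
such that both `f` and its inverse are partial endomorphisms of `G`. -/
def PAut {V : Type*} (G : SimpleGraph V) : Submonoid (V ≃. V) where
  carrier := {f | G.IsPartialEndomorphism f ∧ G.IsPartialEndomorphism f.symm}
  one_mem' := by
    constructor <;>
    · intro u v x y hu hv h
      cases hu
      cases hv
      exact h
  mul_mem' := by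
    rintro f g ⟨hf, hf'⟩ ⟨hg, hg'⟩
    constructor
    · intro u v x y hu hv h
      obtain ⟨a, ha, hx⟩ := Option.bind_eq_some_iff.mp hu
      obtain ⟨b, hb, hy⟩ := Option.bind_eq_some_iff.mp hv
      exact hg hx hy (hf ha hb h)
    · intro u v x y hu hv h
      obtain ⟨a, ha, hx⟩ := Option.bind_eq_some_iff.mp hu
      obtain ⟨b, hb, hy⟩ := Option.bind_eq_some_iff.mp hv
      exact hf' hx hy (hg' ha hb h)

end SimpleGraph

/-- The rank of a monoid: the least number of elements of a generating set of the monoid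
(`⊤` if the monoid is not finitely generated). -/
noncomputable def Monoid.minGenerators (M : Type*) [Monoid M] : ℕ∞ :=
  ⨅ S : {S : Set M // Submonoid.closure S = ⊤}, (S : Set M).encard

/-! Number the vertices 0, …, n - 1. The generators are the prefix reversals `flip n i`, which are
undefined exactly at `i`; `flip n n` is the reflection. They generate everything (`pAut_le_flips`),
by downward induction on the size of the domain. A total map is the identity or the reflection.
Otherwise the image is moved by reversals until the map extends to one more vertex
(`extendable_of_gap`, `extendable_of_last`). The extension is a product of reversals by induction;
restrictions cost nothing, since `flip n i * flip n i` is the idempotent deleting `i`, and the moves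
can be undone. For `i ≤ 1` the reversal is itself such an idempotent, hence a reflected copy of the
one deleting `n - 1 - i`. So `flip n 2, …, flip n n` suffice when `n ≥ 4`; when `n = 3` the vertex 1
is its own mirror image and `flip 3 1` is kept. Conversely, a generating set contains a total map
and, for each mirror pair {m, n - 1 - m}, a map missing exactly one vertex of that pair. If `2 ≤ m`
and `2 * m + 1 < n`, deleting `m` leaves two components of different lengths, each with at least two
vertices. Up to reflection, a map acts on them by reversing each or not, an element of (ℤ/2)². One
generator of the class yields at most two such elements, but two different nontrivial ones occur, so
two generators are needed (`exists_two_inClass_mem`). -/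

namespace PathPAut

variable {n : ℕ}

/-! ### Partial maps as relations on natural numbers -/

/-- `f` sends the vertex with value `x` to the vertex with value `y`. -/
def Maps (f : Fin n ≃. Fin n) (x y : ℕ) : Prop :=
  ∃ (hx : x < n) (hy : y < n), f ⟨x, hx⟩ = some ⟨y, hy⟩

theorem Maps.lt_left {f : Fin n ≃. Fin n} {x y : ℕ} (h : Maps f x y) : x < n := h.1

theorem Maps.lt_right {f : Fin n ≃. Fin n} {x y : ℕ} (h : Maps f x y) : y < n := h.2.1

theorem maps_val {f : Fin n ≃. Fin n} {x y : Fin n} : Maps f x y ↔ f x = some y := by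
  simp [Maps]

theorem Maps.right_unique {f : Fin n ≃. Fin n} {x y z : ℕ} (h : Maps f x y) (h' : Maps f x z) :
    y = z := by
  obtain ⟨hx, hy, h⟩ := h
  obtain ⟨_, hz, h'⟩ := h'
  simpa using h.symm.trans h'

theorem maps_symm {f : Fin n ≃. Fin n} {x y : ℕ} : Maps f.symm x y ↔ Maps f y x := by
  constructor
  · rintro ⟨hx, hy, h⟩
    exact ⟨hy, hx, f.eq_some_iff.1 h⟩
  · rintro ⟨hx, hy, h⟩
    exact ⟨hy, hx, f.eq_some_iff.2 h⟩

theorem Maps.left_unique {f : Fin n ≃. Fin n} {x y z : ℕ} (h : Maps f x z) (h' : Maps f y z) :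
    x = y :=
  (maps_symm.2 h).right_unique (maps_symm.2 h')

theorem maps_mul {f g : Fin n ≃. Fin n} {x z : ℕ} :
    Maps (f * g) x z ↔ ∃ y, Maps f x y ∧ Maps g y z := by
  constructor
  · rintro ⟨hx, hz, h⟩
    obtain ⟨y, hy, hyz⟩ := Option.bind_eq_some_iff.mp h
    exact ⟨y, ⟨hx, y.2, hy⟩, ⟨y.2, hz, hyz⟩⟩
  · rintro ⟨y, ⟨hx, hy, h⟩, ⟨_, hz, h'⟩⟩
    exact ⟨hx, hz, Option.bind_eq_some_iff.mpr ⟨_, h, h'⟩⟩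

theorem maps_one {x y : ℕ} : Maps (1 : Fin n ≃. Fin n) x y ↔ x < n ∧ x = y := by
  constructor
  · rintro ⟨hx, hy, h⟩
    have : some (⟨x, hx⟩ : Fin n) = some ⟨y, hy⟩ := h
    exact ⟨hx, by simpa using this⟩
  · rintro ⟨hx, rfl⟩
    exact ⟨hx, hx, rfl⟩

theorem ext_maps {f g : Fin n ≃. Fin n} (h : ∀ x y, Maps f x y ↔ Maps g x y) : f = g := by
  apply PEquiv.ext
  intro x
  apply Option.ext
  intro y
  have := h x y
  rwa [maps_val, maps_val] at this

/-- The vertex with value `x` lies in the domain of `f`. -/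
def InDom (f : Fin n ≃. Fin n) (x : ℕ) : Prop := ∃ y, Maps f x y

/-- The vertex with value `y` lies in the image of `f`. -/
def InIm (f : Fin n ≃. Fin n) (y : ℕ) : Prop := ∃ x, Maps f x y

theorem inDom_symm {f : Fin n ≃. Fin n} {x : ℕ} : InDom f.symm x ↔ InIm f x := by
  simp [InDom, InIm, maps_symm]

theorem inIm_symm {f : Fin n ≃. Fin n} {x : ℕ} : InIm f.symm x ↔ InDom f x := by
  simp [InDom, InIm, maps_symm]

theorem mem_pAut_iff {f : Fin n ≃. Fin n} :
    f ∈ (SimpleGraph.pathGraph n).PAut ↔ ∀ x y u v, Maps f x u → Maps f y v →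
      ((x + 1 = y ∨ y + 1 = x) ↔ (u + 1 = v ∨ v + 1 = u)) := by
  constructor
  · rintro ⟨h, h'⟩ x y u v ⟨hx, hu, e⟩ ⟨hy, hv, e'⟩
    have a := h e e'
    have b := h' (f.eq_some_iff.2 e) (f.eq_some_iff.2 e')
    rw [SimpleGraph.pathGraph_adj, SimpleGraph.pathGraph_adj] at a b
    exact ⟨a, b⟩
  · intro h
    constructor
    · intro u v x y hu hv
      rw [SimpleGraph.pathGraph_adj, SimpleGraph.pathGraph_adj]
      exact (h _ _ _ _ (maps_val.2 hu) (maps_val.2 hv)).1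
    · intro u v x y hu hv
      rw [SimpleGraph.pathGraph_adj, SimpleGraph.pathGraph_adj]
      exact (h _ _ _ _ (maps_val.2 (f.eq_some_iff.1 hu)) (maps_val.2 (f.eq_some_iff.1 hv))).2

theorem symm_mem_pAut {f : Fin n ≃. Fin n} (hf : f ∈ (SimpleGraph.pathGraph n).PAut) :
    f.symm ∈ (SimpleGraph.pathGraph n).PAut :=
  ⟨hf.2, by simpa using hf.1⟩

/-! ### Prefix reversals and the monoid they generate -/

/-- The prefix reversal: it reverses `0, …, i - 1`, is undefined at `i`, and fixes the vertices
beyond `i`. For `i = n` it is the reflection of the path. -/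
def flip (n i : ℕ) : Fin n ≃. Fin n where
  toFun x := if h : (x : ℕ) < i ∧ i ≤ n then some ⟨i - 1 - x, by omega⟩
    else if (x : ℕ) = i then none else some x
  invFun x := if h : (x : ℕ) < i ∧ i ≤ n then some ⟨i - 1 - x, by omega⟩
    else if (x : ℕ) = i then none else some x
  inv a b := by
    split_ifs <;> simp [Fin.ext_iff] <;> omega

theorem maps_flip {i x y : ℕ} (hi : i ≤ n) :
    Maps (flip n i) x y ↔ x < n ∧ (x < i ∧ x + y + 1 = i ∨ i < x ∧ y = x) := by
  have key : ∀ (hx : x < n), flip n i ⟨x, hx⟩ =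
      if h : x < i ∧ i ≤ n then some ⟨i - 1 - x, by omega⟩
        else if x = i then none else some ⟨x, hx⟩ := fun _ => rfl
  constructor
  · rintro ⟨hx, hy, h⟩
    rw [key] at h
    split_ifs at h <;> simp at h <;> omega
  · rintro ⟨hx, h⟩
    refine ⟨hx, by omega, ?_⟩
    rw [key]
    split_ifs <;> first | omega | (simp only [Option.some.injEq, Fin.mk.injEq]; omega)

theorem flip_mem_pAut {i : ℕ} (hi : i ≤ n) : flip n i ∈ (SimpleGraph.pathGraph n).PAut := by
  rw [mem_pAut_iff]
  intro x y u v h h'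
  rw [maps_flip hi] at h h'
  omega

theorem maps_flip_mul_flip {i x y : ℕ} (hi : i ≤ n) :
    Maps (flip n i * flip n i) x y ↔ x < n ∧ x ≠ i ∧ x = y := by
  simp only [maps_mul, maps_flip hi]
  constructor
  · rintro ⟨z, h⟩
    omega
  · rintro ⟨h, h', rfl⟩
    by_cases hx : x < i
    · exact ⟨i - 1 - x, by omega⟩
    · exact ⟨x, by omega⟩

/-- The monoid generated by all prefix reversals. -/
def flips (n : ℕ) : Submonoid (Fin n ≃. Fin n) :=
  Submonoid.closure {f | ∃ i ≤ n, f = flip n i}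

theorem flip_mem_flips {i : ℕ} (hi : i ≤ n) : flip n i ∈ flips n :=
  Submonoid.subset_closure ⟨i, hi, rfl⟩

theorem flips_le_pAut : flips n ≤ (SimpleGraph.pathGraph n).PAut := by
  rw [flips, Submonoid.closure_le]
  rintro _ ⟨i, hi, rfl⟩
  exact flip_mem_pAut hi

theorem symm_mem_flips {f : Fin n ≃. Fin n} (hf : f ∈ flips n) : f.symm ∈ flips n := by
  induction hf using Submonoid.closure_induction with
  | mem f hf =>
    obtain ⟨i, hi, rfl⟩ := hf
    exact flip_mem_flips hi
  | one => exact one_mem _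
  | mul f g _ _ hf hg => exact mul_mem hg hf

/-- The square of `flip n i` is the identity off `i`, so products of such squares give every partial
identity. -/
theorem ofSet_mem_flips (s : Finset ℕ) (hs : ∀ i ∈ s, i < n) :
    ∃ e ∈ flips n, ∀ x y, Maps e x y ↔ x < n ∧ x ∉ s ∧ x = y := by
  induction s using Finset.induction_on with
  | empty => exact ⟨1, one_mem _, by simp [maps_one]⟩
  | insert i s _ ih =>
    obtain ⟨e, he, h⟩ := ih fun j hj => hs j (Finset.mem_insert_of_mem hj)
    have hi : i ≤ n := (hs i (Finset.mem_insert_self i s)).le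
    refine ⟨e * (flip n i * flip n i),
      mul_mem he (mul_mem (flip_mem_flips hi) (flip_mem_flips hi)), fun x y => ?_⟩
    rw [maps_mul]
    simp only [h, maps_flip_mul_flip hi, Finset.mem_insert, not_or]
    constructor
    · rintro ⟨z, ⟨a, b, rfl⟩, c, d, rfl⟩
      exact ⟨a, ⟨d, b⟩, rfl⟩
    · rintro ⟨a, ⟨b, c⟩, rfl⟩
      exact ⟨x, ⟨a, c, rfl⟩, a, b, rfl⟩

/-- The monoid generated by the prefix reversals is closed under restriction. -/
theorem mem_flips_of_le {f g : Fin n ≃. Fin n} (hg : g ∈ flips n)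
    (h : ∀ x y, Maps f x y → Maps g x y) : f ∈ flips n := by
  classical
  obtain ⟨e, he, h'⟩ := ofSet_mem_flips (n := n) ((Finset.range n).filter fun x => ¬ InDom f x)
    (by simp +contextual)
  have : f = e * g := by
    refine ext_maps fun x y => ?_
    rw [maps_mul]
    simp only [h', Finset.mem_filter, Finset.mem_range, not_and, not_not]
    constructor
    · intro hf
      exact ⟨x, ⟨hf.lt_left, fun _ => ⟨y, hf⟩, rfl⟩, h _ _ hf⟩
    · rintro ⟨z, ⟨hx, hd, rfl⟩, hz⟩
      obtain ⟨w, hw⟩ := hd hx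
      rwa [hz.right_unique (h _ _ hw)]
  rw [this]
  exact mul_mem he hg

/-! ### Moving the image by prefix reversals -/

/-- `f'` arises from `f` by postcomposition with a product of prefix reversals that is defined
on the image of `f`. -/
def Rearranges (f f' : Fin n ≃. Fin n) : Prop :=
  ∃ h ∈ flips n, f' = f * h ∧ ∀ y, InIm f y → InDom h y

theorem Rearranges.refl (f : Fin n ≃. Fin n) : Rearranges f f :=
  ⟨1, one_mem _, (mul_one f).symm, fun y ⟨_, hx⟩ => ⟨y, maps_one.2 ⟨hx.lt_right, rfl⟩⟩⟩

theorem Rearranges.trans {f g k : Fin n ≃. Fin n} (h : Rearranges f g) (h' : Rearranges g k) :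
    Rearranges f k := by
  obtain ⟨a, ha, rfl, hd⟩ := h
  obtain ⟨b, hb, rfl, hd'⟩ := h'
  refine ⟨a * b, mul_mem ha hb, mul_assoc _ _ _, ?_⟩
  rintro y ⟨x, hx⟩
  obtain ⟨z, hz⟩ := hd y ⟨x, hx⟩
  obtain ⟨w, hw⟩ := hd' z ⟨x, maps_mul.2 ⟨y, hx, hz⟩⟩
  exact ⟨w, maps_mul.2 ⟨z, hz, hw⟩⟩

theorem Rearranges.mem_pAut {f f' : Fin n ≃. Fin n} (h : Rearranges f f')
    (hf : f ∈ (SimpleGraph.pathGraph n).PAut) : f' ∈ (SimpleGraph.pathGraph n).PAut := by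
  obtain ⟨a, ha, rfl, _⟩ := h
  exact mul_mem hf (flips_le_pAut ha)

/-- Since `h` is defined on the whole image of `f`, the map `f` is a restriction of `f * h *
h.symm`. -/
theorem Rearranges.mem_flips {f f' : Fin n ≃. Fin n} (h : Rearranges f f')
    (hf : f' ∈ flips n) : f ∈ flips n := by
  obtain ⟨a, ha, rfl, hd⟩ := h
  refine mem_flips_of_le (mul_mem hf (symm_mem_flips ha)) fun x y hxy => ?_
  obtain ⟨z, hz⟩ := hd y ⟨x, hxy⟩
  exact maps_mul.2 ⟨z, maps_mul.2 ⟨y, hxy, hz⟩, maps_symm.2 hz⟩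

theorem Rearranges.inDom_iff {f f' : Fin n ≃. Fin n} (h : Rearranges f f') {x : ℕ} :
    InDom f' x ↔ InDom f x := by
  obtain ⟨a, ha, rfl, hd⟩ := h
  constructor
  · rintro ⟨z, hz⟩
    obtain ⟨y, hy, _⟩ := maps_mul.1 hz
    exact ⟨y, hy⟩
  · rintro ⟨y, hy⟩
    obtain ⟨z, hz⟩ := hd y ⟨x, hy⟩
    exact ⟨z, maps_mul.2 ⟨y, hy, hz⟩⟩

theorem rearranges_mul_flip {f : Fin n ≃. Fin n} {i : ℕ} (hi : i ≤ n) (h : ¬ InIm f i) :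
    Rearranges f (f * flip n i) := by
  refine ⟨_, flip_mem_flips hi, rfl, fun y hy => ?_⟩
  have hne : y ≠ i := by
    rintro rfl
    exact h hy
  have hlt : y < n := hy.choose_spec.lt_right
  by_cases hyi : y < i
  · exact ⟨i - 1 - y, (maps_flip hi).2 (by omega)⟩
  · exact ⟨y, (maps_flip hi).2 (by omega)⟩

theorem maps_mul_flip {f : Fin n ≃. Fin n} {i x y : ℕ} (hi : i ≤ n) :
    Maps (f * flip n i) x y ↔
      y + 1 ≤ i ∧ Maps f x (i - 1 - y) ∨ i < y ∧ Maps f x y := by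
  simp only [maps_mul, maps_flip hi]
  constructor
  · rintro ⟨z, hz, hlt, ⟨h, h'⟩ | ⟨h, rfl⟩⟩
    · left
      refine ⟨by omega, ?_⟩
      convert hz using 1
      omega
    · exact Or.inr ⟨h, hz⟩
  · rintro (⟨h, h'⟩ | ⟨h, h'⟩)
    · exact ⟨_, h', h'.lt_right, by omega⟩
    · exact ⟨_, h', h'.lt_right, by omega⟩

theorem inIm_mul_flip {f : Fin n ≃. Fin n} {i y : ℕ} (hi : i ≤ n) :
    InIm (f * flip n i) y ↔ y + 1 ≤ i ∧ InIm f (i - 1 - y) ∨ i < y ∧ InIm f y := by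
  simp only [InIm, maps_mul_flip hi, exists_or, exists_and_left]

theorem not_inIm_of_le {f : Fin n ≃. Fin n} {y : ℕ} (h : n ≤ y) : ¬ InIm f y :=
  fun ⟨_, hx⟩ => absurd hx.lt_right (by omega)

/-! ### Extensions and neighbours of gaps -/

/-- A partial automorphism extends to a vertex that is adjacent to the same vertices of the
domain as the prescribed image to the vertices of the image. -/
theorem exists_extension {f : Fin n ≃. Fin n} (hf : f ∈ (SimpleGraph.pathGraph n).PAut) {a b : ℕ}
    (ha : a < n) (hb : b < n) (hda : ¬ InDom f a) (hib : ¬ InIm f b)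
    (h : ∀ x y, Maps f x y → ((x + 1 = a ∨ a + 1 = x) ↔ (y + 1 = b ∨ b + 1 = y))) :
    ∃ g ∈ (SimpleGraph.pathGraph n).PAut, (∀ x y, Maps f x y → Maps g x y) ∧ Maps g a b := by
  have hfa : ∀ y, f ⟨a, ha⟩ ≠ some y := fun y hy => hda ⟨y, maps_val.2 hy⟩
  have hfb : ∀ x, f x ≠ some ⟨b, hb⟩ := fun x hx => hib ⟨x, maps_val.2 hx⟩
  have hfb' : ∀ y, f.symm ⟨b, hb⟩ ≠ some y := fun y hy => hfb y (f.eq_some_iff.1 hy)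
  let g : Fin n ≃. Fin n :=
    { toFun := fun x => if x = ⟨a, ha⟩ then some ⟨b, hb⟩ else f x
      invFun := fun y => if y = ⟨b, hb⟩ then some ⟨a, ha⟩ else f.symm y
      inv := by
        intro x y
        by_cases hx : x = ⟨a, ha⟩ <;> by_cases hy : y = ⟨b, hb⟩
        · simp [hx, hy]
        · have : f.symm y ≠ some x := by
            rw [hx]
            exact fun e => hfa y (f.eq_some_iff.1 e)
          simp [hx, hy, Ne.symm hy]
          rwa [hx] at this
        · have := hfb x
          simp [hx, hy, Ne.symm hx]
          exact this
        · simp only [hx, hy, if_false]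
          exact f.eq_some_iff }
  have hg : ∀ x y, Maps g x y ↔ Maps f x y ∨ x = a ∧ y = b := by
    intro x y
    have key : ∀ x, g x = if x = ⟨a, ha⟩ then some ⟨b, hb⟩ else f x := fun _ => rfl
    constructor
    · rintro ⟨hx, hy, e⟩
      rw [key] at e
      split_ifs at e with hxa
      · right
        simp at hxa e
        exact ⟨hxa, e.symm⟩
      · exact Or.inl ⟨hx, hy, e⟩
    · rintro (h' | ⟨rfl, rfl⟩)
      · have hxa : x ≠ a := by
          rintro rfl
          exact hda ⟨y, h'⟩
        obtain ⟨hx, hy, e⟩ := h'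
        refine ⟨hx, hy, ?_⟩
        rw [key, if_neg (by simpa using hxa), e]
      · exact ⟨ha, hb, by rw [key, if_pos rfl]⟩
  refine ⟨g, ?_, fun x y hxy => (hg x y).2 (Or.inl hxy), (hg a b).2 (Or.inr ⟨rfl, rfl⟩)⟩
  rw [mem_pAut_iff] at hf ⊢
  intro x y u v hx hy
  rcases (hg _ _).1 hx with hx | ⟨rfl, rfl⟩ <;> rcases (hg _ _).1 hy with hy | ⟨rfl, rfl⟩
  · exact hf _ _ _ _ hx hy
  · exact h _ _ ‹_›
  · rw [or_comm, h _ _ hy, or_comm]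
  · omega

/-- A vertex of the domain with a neighbour outside the domain is mapped to a vertex
with a neighbour outside the image. -/
theorem not_inIm_and_inIm {f : Fin n ≃. Fin n} (hf : f ∈ (SimpleGraph.pathGraph n).PAut)
    {a u i : ℕ} (ha : Maps f a u) (hi : ¬ InDom f i) (hai : a + 1 = i ∨ i + 1 = a) (hu : 0 < u) :
    ¬ (InIm f (u - 1) ∧ InIm f (u + 1)) := by
  rintro ⟨⟨x, hx⟩, ⟨y, hy⟩⟩
  rw [mem_pAut_iff] at hf
  have h1 := (hf _ _ _ _ ha hx).2 (by omega)
  have h2 := (hf _ _ _ _ ha hy).2 (by omega)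
  -- The preimages `x` and `y` are two distinct neighbours of `a`, both different from the neighbour
  -- `i`; a vertex of a path has at most two.
  have hxy : x ≠ y := by
    rintro rfl
    have := hx.right_unique hy
    omega
  have hxi : x ≠ i := by
    rintro rfl
    exact hi ⟨_, hx⟩
  have hyi : y ≠ i := by
    rintro rfl
    exact hi ⟨_, hy⟩
  omega

theorem exists_rearranges_maps_zero_of_not_inIm_succ {f : Fin n ≃. Fin n} {a u : ℕ}
    (ha : Maps f a u) (hu : ¬ InIm f (u + 1)) : ∃ f', Rearranges f f' ∧ Maps f' a 0 := by
  have hlt := ha.lt_right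
  refine ⟨_, rearranges_mul_flip (by omega : u + 1 ≤ n) hu, ?_⟩
  rw [maps_mul_flip (by omega)]
  exact Or.inl ⟨by omega, by simpa using ha⟩

/-- One neighbour of `u` is missing from the image or `u` is 0. If `u + 1` is missing, reversing the
prefix that ends in `u` brings `u` to 0; if `u - 1` is missing, the reflection reduces to that case.
-/
theorem exists_rearranges_maps_zero {f : Fin n ≃. Fin n}
    (hf : f ∈ (SimpleGraph.pathGraph n).PAut) {a u i : ℕ} (ha : Maps f a u) (hi : ¬ InDom f i)
    (hai : a + 1 = i ∨ i + 1 = a) : ∃ f', Rearranges f f' ∧ Maps f' a 0 := by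
  have hlt := ha.lt_right
  by_cases h1 : InIm f (u + 1)
  · rcases Nat.eq_zero_or_pos u with rfl | hu
    · exact ⟨f, .refl f, ha⟩
    · have h2 : ¬ InIm f (u - 1) := fun h => not_inIm_and_inIm hf ha hi hai hu ⟨h, h1⟩
      have hr := rearranges_mul_flip le_rfl (not_inIm_of_le (f := f) (le_refl n))
      obtain ⟨f', hr', h'⟩ := exists_rearranges_maps_zero_of_not_inIm_succ
        (f := f * flip n n) (a := a) (u := n - 1 - u)
        (by
          rw [maps_mul_flip le_rfl]
          refine Or.inl ⟨by omega, ?_⟩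
          rwa [show n - 1 - (n - 1 - u) = u by omega])
        (by
          rw [inIm_mul_flip le_rfl]
          rintro (⟨h, h'⟩ | ⟨h, _⟩)
          · rw [show n - 1 - (n - 1 - u + 1) = u - 1 by omega] at h'
            exact h2 h'
          · omega)
      exact ⟨f', hr.trans hr', h'⟩
  · exact exists_rearranges_maps_zero_of_not_inIm_succ ha h1

/-! ### Rigidity on intervals -/

/-- A sequence with steps of length one that does not turn back is monotone. -/
theorem eq_add_or_add_eq {φ : ℕ → ℕ} {q : ℕ}
    (h1 : ∀ j < q, φ j + 1 = φ (j + 1) ∨ φ (j + 1) + 1 = φ j)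
    (h2 : ∀ j, j + 1 < q → φ j ≠ φ (j + 2)) :
    (∀ j ≤ q, φ j = φ 0 + j) ∨ (∀ j ≤ q, φ j + j = φ 0) := by
  induction q with
  | zero =>
    left
    intro j hj
    obtain rfl : j = 0 := by omega
    rfl
  | succ q ih =>
    have key := h1 q (by omega)
    rcases ih (fun j hj => h1 j (by omega)) (fun j hj => h2 j (by omega)) with h | h
    · rcases Nat.eq_zero_or_pos q with rfl | hq
      · rcases key with k | k
        · left
          intro j hj
          rcases (by omega : j = 0 ∨ j = 1) with rfl | rfl
          · rfl
          · simpa using k.symm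
        · right
          intro j hj
          rcases (by omega : j = 0 ∨ j = 1) with rfl | rfl
          · rfl
          · omega
      · left
        intro j hj
        rcases Nat.lt_or_ge q j with hj' | hj'
        · obtain rfl : j = q + 1 := by omega
          have a := h q le_rfl
          have b := h (q - 1) (by omega)
          have c := h2 (q - 1) (by omega)
          rw [show q - 1 + 2 = q + 1 by omega] at c
          omega
        · exact h j hj'
    · rcases Nat.eq_zero_or_pos q with rfl | hq
      · rcases key with k | k
        · left
          intro j hj
          rcases (by omega : j = 0 ∨ j = 1) with rfl | rfl
          · rfl
          · simpa using k.symm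
        · right
          intro j hj
          rcases (by omega : j = 0 ∨ j = 1) with rfl | rfl
          · rfl
          · omega
      · right
        intro j hj
        rcases Nat.lt_or_ge q j with hj' | hj'
        · obtain rfl : j = q + 1 := by omega
          have a := h q le_rfl
          have b := h (q - 1) (by omega)
          have c := h2 (q - 1) (by omega)
          rw [show q - 1 + 2 = q + 1 by omega] at c
          omega
        · exact h j hj'

/-- A partial automorphism is affine with slope `±1` on an initial segment of its domain. -/
theorem affine_of_forall_inDom {f : Fin n ≃. Fin n} (hf : f ∈ (SimpleGraph.pathGraph n).PAut)
    {q : ℕ} (h : ∀ j ≤ q, InDom f j) :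
    ∃ c, (∀ j ≤ q, Maps f j (c + j)) ∨ (∀ j ≤ q, j ≤ c ∧ Maps f j (c - j)) := by
  rw [mem_pAut_iff] at hf
  choose! φ hφ using h
  refine ⟨φ 0, ?_⟩
  rcases eq_add_or_add_eq (φ := φ) (q := q)
    (fun j hj => (hf _ _ _ _ (hφ j hj.le) (hφ (j + 1) hj)).1 (Or.inl rfl))
    (fun j hj e => by
      have a := hφ j (by omega)
      rw [e] at a
      have := a.left_unique (hφ (j + 2) (by omega))
      omega) with h | h
  · left
    intro j hj
    rw [← h j hj]
    exact hφ j hj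
  · right
    intro j hj
    have := h j hj
    refine ⟨by omega, ?_⟩
    rw [show φ 0 - j = φ j by omega]
    exact hφ j hj

/-- The only automorphisms of the path are the identity and the reflection. -/
theorem eq_one_or_eq_flip {f : Fin n ≃. Fin n} (hf : f ∈ (SimpleGraph.pathGraph n).PAut)
    (h : ∀ j < n, InDom f j) : f = 1 ∨ f = flip n n := by
  rcases Nat.eq_zero_or_pos n with rfl | hn
  · left
    exact ext_maps fun x y => ⟨fun h => absurd h.lt_left (by omega),
      fun h => absurd h.lt_left (by omega)⟩
  · obtain ⟨c, hc | hc⟩ := affine_of_forall_inDom hf (q := n - 1) fun j hj => h j (by omega)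
    · left
      have := (hc (n - 1) le_rfl).lt_right
      obtain rfl : c = 0 := by omega
      refine ext_maps fun x y => ?_
      rw [maps_one]
      constructor
      · intro hxy
        have := hc x (by have := hxy.lt_left; omega)
        have := hxy.right_unique this
        exact ⟨hxy.lt_left, by omega⟩
      · rintro ⟨hx, rfl⟩
        simpa using hc x (by omega)
    · right
      have h1 := hc (n - 1) le_rfl
      have h2 := (hc 0 (by omega)).2.lt_right
      obtain rfl : c = n - 1 := by omega
      refine ext_maps fun x y => ?_
      rw [maps_flip le_rfl]
      constructor
      · intro hxy
        have hx := hxy.lt_left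
        have := hc x (by omega)
        have := hxy.right_unique this.2
        omega
      · rintro ⟨hx, h⟩
        rw [show y = n - 1 - x by omega]
        exact (hc x (by omega)).2

/-! ### Extending a rearrangement -/

/-- The size of the domain. -/
noncomputable def size (f : Fin n ≃. Fin n) : ℕ := {x | InDom f x}.ncard

theorem finite_inDom (f : Fin n ≃. Fin n) : {x | InDom f x}.Finite :=
  (Set.finite_lt_nat n).subset fun _ ⟨_, hy⟩ => hy.lt_left

theorem size_symm (f : Fin n ≃. Fin n) : size f.symm = size f := by
  unfold size
  symm
  refine Set.ncard_congr (fun x hx => Classical.choose hx) ?_ ?_ ?_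
  · intro x hx
    exact ⟨x, maps_symm.2 (Classical.choose_spec hx)⟩
  · intro x y hx hy e
    have h1 := Classical.choose_spec hx
    rw [e] at h1
    exact h1.left_unique (Classical.choose_spec hy)
  · rintro y ⟨x, hx⟩
    refine ⟨x, ⟨y, maps_symm.1 hx⟩, ?_⟩
    exact (Classical.choose_spec (⟨y, maps_symm.1 hx⟩ : InDom f x)).right_unique (maps_symm.1 hx)

theorem size_le (f : Fin n ≃. Fin n) : size f ≤ n := by
  have : {x | InDom f x} ⊆ (Finset.range n : Set ℕ) := fun x ⟨_, hy⟩ => by simpa using hy.lt_left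
  have := Set.ncard_le_ncard this (Finset.finite_toSet _)
  rwa [Set.ncard_coe_finset, Finset.card_range] at this

/-- Some rearrangement of `f` has a proper extension. -/
def Extendable (f : Fin n ≃. Fin n) : Prop :=
  ∃ f' g, Rearranges f f' ∧ g ∈ (SimpleGraph.pathGraph n).PAut ∧
    (∀ x y, Maps f' x y → Maps g x y) ∧ ∃ a, ¬ InDom f a ∧ InDom g a

theorem Extendable.mem_flips {f : Fin n ≃. Fin n} (h : Extendable f)
    (ih : ∀ g ∈ (SimpleGraph.pathGraph n).PAut, size f < size g → g ∈ flips n) : f ∈ flips n := by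
  obtain ⟨f', g, hr, hg, hle, a, ha, hga⟩ := h
  refine hr.mem_flips (mem_flips_of_le (ih g hg ?_) hle)
  refine Set.ncard_lt_ncard ⟨?_, fun h => ha (h hga)⟩ (finite_inDom g)
  intro x hx
  obtain ⟨y, hy⟩ := hr.inDom_iff.2 hx
  exact ⟨y, hle _ _ hy⟩

/-- The reversal of the vertices beyond `l`, undefined at `l`. -/
theorem exists_rearranges_suffix {f : Fin n ≃. Fin n} {l : ℕ} (hl : l < n) (h : ¬ InIm f l) :
    ∃ f', Rearranges f f' ∧ ∀ x y, Maps f' x y ↔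
      (y < l ∧ Maps f x y ∨ l < y ∧ y < n ∧ Maps f x (n + l - y)) := by
  -- Reflect, reverse the prefix of length `n - 1 - l`, and reflect back.
  have hr := rearranges_mul_flip le_rfl (not_inIm_of_le (f := f) (le_refl n))
  have h1 : ¬ InIm (f * flip n n) (n - 1 - l) := by
    rw [inIm_mul_flip le_rfl]
    rintro (⟨_, h'⟩ | ⟨h', _⟩)
    · rw [show n - 1 - (n - 1 - l) = l by omega] at h'
      exact h h'
    · omega
  have hr1 := rearranges_mul_flip (by omega) h1
  have hr2 := rearranges_mul_flip le_rfl
    (not_inIm_of_le (f := f * flip n n * flip n (n - 1 - l)) (le_refl n))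
  refine ⟨_, (hr.trans hr1).trans hr2, fun x y => ?_⟩
  rw [maps_mul_flip le_rfl, maps_mul_flip (by omega), maps_mul_flip le_rfl, maps_mul_flip le_rfl]
  constructor
  · rintro (⟨h1, ⟨h2, ⟨h3, h4⟩ | ⟨h3, h4⟩⟩ | ⟨h2, ⟨h3, h4⟩ | ⟨h3, h4⟩⟩⟩ | ⟨h1, h2⟩)
    · right
      refine ⟨by omega, by omega, ?_⟩
      convert h4 using 1
      omega
    · omega
    · left
      refine ⟨by omega, ?_⟩
      convert h4 using 1
      omega
    · omega
    · exact absurd h2.lt_right (by omega)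
  · rintro (⟨h1, h2⟩ | ⟨h1, h2, h3⟩)
    · left
      refine ⟨by omega, Or.inr ⟨by omega, Or.inl ⟨by omega, ?_⟩⟩⟩
      convert h2 using 1
      omega
    · left
      refine ⟨by omega, Or.inl ⟨by omega, Or.inl ⟨by omega, ?_⟩⟩⟩
      convert h3 using 1
      omega

/-- If the domain misses a vertex but contains both its neighbours, then some rearrangement
extends to this vertex. -/
theorem extendable_of_gap {f : Fin n ≃. Fin n} (hf : f ∈ (SimpleGraph.pathGraph n).PAut) {i : ℕ}
    (h0 : InDom f i) (h1 : ¬ InDom f (i + 1)) (h2 : InDom f (i + 2)) : Extendable f := by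
  -- It suffices to separate the images of the neighbours by a gap of length one.
  suffices h : ∃ f' w, Rearranges f f' ∧ Maps f' i w ∧ ¬ InIm f' (w + 1) ∧ Maps f' (i + 2) (w + 2) by
    obtain ⟨f', w, hr, a, b, c⟩ := h
    have hlt := c.lt_right
    obtain ⟨g, hg, hle, hgi⟩ := exists_extension (hr.mem_pAut hf) (a := i + 1) (b := w + 1)
      (by have := h2.choose_spec.lt_left; omega) (by omega) (by rwa [hr.inDom_iff]) b (by
        intro x y hxy
        constructor
        · rintro (h | h)
          · obtain rfl : x = i := by omega
            exact Or.inl (by rw [a.right_unique hxy])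
          · obtain rfl : x = i + 2 := by omega
            exact Or.inr (by rw [← c.right_unique hxy])
        · rintro (h | h)
          · obtain rfl : y = w := by omega
            exact Or.inl (by rw [a.left_unique hxy])
          · obtain rfl : y = w + 2 := by omega
            exact Or.inr (by rw [← c.left_unique hxy]))
    exact ⟨f', g, hr, hg, hle, i + 1, h1, _, hgi⟩
  obtain ⟨u, hu⟩ := h0
  obtain ⟨f₁, hr₁, hi₁⟩ := exists_rearranges_maps_zero hf hu h1 (Or.inl rfl)
  have hf₁ := hr₁.mem_pAut hf
  obtain ⟨q, hq⟩ := hr₁.inDom_iff.2 h2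
  have hqn := hq.lt_right
  have hq0 : q ≠ 0 := by
    rintro rfl
    have := hi₁.left_unique hq
    omega
  -- With `i` sent to 0, it remains to make the place just before the image of `i + 2` empty.
  obtain ⟨f₂, r, hr₂, hi₂, hr, hgap⟩ : ∃ f₂ r, Rearranges f₁ f₂ ∧ Maps f₂ i 0 ∧
      Maps f₂ (i + 2) r ∧ ¬ InIm f₂ (r - 1) := by
    by_cases hp : InIm f₁ (q - 1)
    · have hs : ¬ InIm f₁ (q + 1) := fun hs =>
        not_inIm_and_inIm hf₁ hq (by rwa [hr₁.inDom_iff]) (Or.inr rfl) (by omega) ⟨hp, hs⟩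
      -- If 0, …, `q` were all in the image, the inverse would be affine there, running from `i` to
      -- `i + 2` through the missing vertex `i + 1`.
      obtain ⟨l, hlq, hl⟩ : ∃ l ≤ q, ¬ InIm f₁ l := by
        by_contra! hall
        obtain ⟨c, hc | hc⟩ := affine_of_forall_inDom (symm_mem_pAut hf₁) (q := q)
          fun j hj => inDom_symm.2 (hall j hj)
        · have e0 := (maps_symm.1 (hc 0 (by omega))).left_unique hi₁
          have eq := (maps_symm.1 (hc q le_rfl)).left_unique hq
          have e1 := maps_symm.1 (hc 1 (by omega))
          apply h1
          rw [← hr₁.inDom_iff]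
          exact ⟨1, by rwa [← show c + 1 = i + 1 by omega]⟩
        · have e0 := (maps_symm.1 (hc 0 (by omega)).2).left_unique hi₁
          have eq := (maps_symm.1 (hc q le_rfl).2).left_unique hq
          omega
      have hl0 : l ≠ 0 := by
        rintro rfl
        exact hl ⟨_, hi₁⟩
      have hlq' : l ≠ q := by
        rintro rfl
        exact hl ⟨_, hq⟩
      -- Reversing everything beyond `l` turns the empty place after `q` into one before its new
      -- position, and leaves 0 fixed.
      obtain ⟨f₂, hr₂, h₂⟩ := exists_rearranges_suffix (by omega) hl
      refine ⟨f₂, n + l - q, hr₂, (h₂ _ _).2 (Or.inl ⟨by omega, hi₁⟩),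
        (h₂ _ _).2 (Or.inr ⟨by omega, by omega, ?_⟩), ?_⟩
      · rwa [show n + l - (n + l - q) = q by omega]
      · rintro ⟨x, hx⟩
        rcases (h₂ _ _).1 hx with ⟨h, _⟩ | ⟨_, _, h⟩
        · omega
        · exact hs ⟨x, by rwa [show n + l - (n + l - q - 1) = q + 1 by omega] at h⟩
    · exact ⟨f₁, q, .refl _, hi₁, hq, hp⟩
  have hr0 : r ≠ 0 := by
    rintro rfl
    have := hi₂.left_unique hr
    omega
  have hr1 : r ≠ 1 := by
    rintro rfl
    exact hgap ⟨_, hi₂⟩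
  have hrn := hr.lt_right
  have hle : r - 1 ≤ n := by omega
  -- Reversing the prefix of length `r - 1` carries 0 to `r - 2` and fixes `r`.
  refine ⟨_, r - 2, (hr₁.trans hr₂).trans (rearranges_mul_flip hle hgap), ?_, ?_, ?_⟩
  · rw [maps_mul_flip hle]
    refine Or.inl ⟨by omega, ?_⟩
    rwa [show r - 1 - 1 - (r - 2) = 0 by omega]
  · rw [inIm_mul_flip hle]
    omega
  · rw [maps_mul_flip hle]
    exact Or.inr ⟨by omega, by rwa [show r - 2 + 2 = r by omega]⟩

/-- If the domain and the image miss the last vertex, then some rearrangement extends. -/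
theorem extendable_of_last {f : Fin n ≃. Fin n} (hf : f ∈ (SimpleGraph.pathGraph n).PAut)
    (hn : 0 < n) (hd : ¬ InDom f (n - 1)) (hi : ¬ InIm f (n - 1)) : Extendable f := by
  by_cases hemp : ∀ x, ¬ InDom f x
  · obtain ⟨g, hg, hle, hga⟩ := exists_extension hf hn hn (hemp 0)
      (fun ⟨x, hx⟩ => hemp x ⟨0, hx⟩) (fun x y hxy => (hemp x ⟨y, hxy⟩).elim)
    exact ⟨f, g, .refl f, hg, hle, 0, hemp 0, 0, hga⟩
  push Not at hemp
  obtain ⟨a, ⟨u, hu⟩, hmax⟩ : ∃ a, InDom f a ∧ ∀ x, InDom f x → x ≤ a := by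
    obtain ⟨a, ha, h⟩ := Set.exists_max_image _ id (finite_inDom f) hemp
    exact ⟨a, ha, h⟩
  have han : a + 1 < n := by
    have := hu.lt_left
    have : a ≠ n - 1 := by
      rintro rfl
      exact hd ⟨_, hu⟩
    omega
  have hds : ¬ InDom f (a + 1) := fun h => by
    have := hmax _ h
    omega
  -- By maximality `a` is the only neighbour of `a + 1` in the domain, so once `a` goes to `n - 2`,
  -- the vertex `a + 1` can be sent to `n - 1`.
  suffices h : ∃ f', Rearranges f f' ∧ ¬ InIm f' (n - 1) ∧ Maps f' a (n - 2) by
    obtain ⟨f', hr, hi', ha⟩ := h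
    obtain ⟨g, hg, hle, hga⟩ := exists_extension (hr.mem_pAut hf) (a := a + 1) (b := n - 1)
      han (by omega) (by rwa [hr.inDom_iff]) hi' (by
        intro x y hxy
        have h1 := hmax x (hr.inDom_iff.1 ⟨y, hxy⟩)
        have h2 := hxy.lt_right
        constructor
        · intro h
          obtain rfl : x = a := by omega
          have := ha.right_unique hxy
          omega
        · intro h
          obtain rfl : y = n - 2 := by omega
          have := ha.left_unique hxy
          omega)
    exact ⟨f', g, hr, hg, hle, a + 1, hds, _, hga⟩
  -- The case in which the gap follows the image of `a`.
  have key : ∀ f' p, Rearranges f f' → ¬ InIm f' (n - 1) → Maps f' a p → ¬ InIm f' (p + 1) →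
      ∃ f', Rearranges f f' ∧ ¬ InIm f' (n - 1) ∧ Maps f' a (n - 2) := by
    intro f' p hr hi' hp hg
    have hpn := hp.lt_right
    have hpn' : p ≠ n - 1 := by
      rintro rfl
      exact hi' ⟨_, hp⟩
    by_cases hp2 : p = n - 2
    · exact ⟨f', hr, hi', hp2 ▸ hp⟩
    · have hle : p + 1 ≤ n := by omega
      have hle' : n - 1 ≤ n := by omega
      -- The first reversal takes `p` to 0, the second takes 0 to `n - 2`; neither fills `n - 1`.
      refine ⟨_, (hr.trans (rearranges_mul_flip hle hg)).trans (rearranges_mul_flip hle' ?_), ?_, ?_⟩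
      · rw [inIm_mul_flip hle]
        rintro (⟨h, _⟩ | ⟨_, h⟩)
        · omega
        · exact hi' h
      · rw [inIm_mul_flip hle']
        omega
      · rw [maps_mul_flip hle', maps_mul_flip hle]
        refine Or.inl ⟨by omega, Or.inl ⟨by omega, ?_⟩⟩
        rwa [show p + 1 - 1 - (n - 1 - 1 - (n - 2)) = p by omega]
  have hun : u < n - 1 := by
    have := hu.lt_right
    have : u ≠ n - 1 := by
      rintro rfl
      exact hi ⟨_, hu⟩
    omega
  -- If `u + 1` is occupied, then `u - 1` is not; reversing 0, …, `n - 2` exchanges the two sides of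
  -- `u`.
  by_cases hs : InIm f (u + 1)
  · have hle' : n - 1 ≤ n := by omega
    refine key _ (n - 2 - u) (rearranges_mul_flip hle' hi) ?_ ?_ ?_
    · rw [inIm_mul_flip hle']
      omega
    · rw [maps_mul_flip hle']
      refine Or.inl ⟨by omega, ?_⟩
      rwa [show n - 1 - 1 - (n - 2 - u) = u by omega]
    · rw [inIm_mul_flip hle']
      rintro (⟨h, h'⟩ | ⟨h, _⟩)
      · rw [show n - 1 - 1 - (n - 2 - u + 1) = u - 1 by omega] at h'
        exact not_inIm_and_inIm hf hu hds (Or.inl rfl) (by omega) ⟨h', hs⟩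
      · omega
  · exact key f u (.refl f) hi hu hs

/-- If the image is not everything and has no gap of length one, then it can be moved off
the last vertex. -/
theorem exists_rearranges_not_inIm_last {f : Fin n ≃. Fin n} {j : ℕ} (hj : j < n)
    (h : ¬ InIm f j)
    (hgap : ∀ i, InIm f i → InIm f (i + 2) → InIm f (i + 1)) :
    ∃ f', Rearranges f f' ∧ ¬ InIm f' (n - 1) := by
  -- The case in which the first vertex is missing.
  have key : ∀ f', Rearranges f f' → ¬ InIm f' 0 → ∃ f', Rearranges f f' ∧ ¬ InIm f' (n - 1) := by
    intro f' hr h0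
    refine ⟨_, hr.trans (rearranges_mul_flip le_rfl (not_inIm_of_le le_rfl)), ?_⟩
    rw [inIm_mul_flip le_rfl]
    rintro (⟨_, h'⟩ | ⟨h', _⟩)
    · simp at h'
      exact h0 h'
    · omega
  have hpair : ∀ i, i + 1 < n → ¬ InIm f i → ¬ InIm f (i + 1) →
      ∃ f', Rearranges f f' ∧ ¬ InIm f' (n - 1) := by
    intro i hi h0 h1
    -- Of two consecutive empty places, reversal at the second moves the first to 0.
    refine key _ (rearranges_mul_flip hi.le h1) ?_
    rw [inIm_mul_flip hi.le]
    rintro (⟨_, h'⟩ | ⟨h', _⟩)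
    · exact h0 (by simpa using h')
    · omega
  rcases Nat.eq_zero_or_pos j with rfl | hj0
  · exact key f (.refl f) h
  by_cases hl : InIm f (n - 1)
  · by_cases hp : InIm f (j - 1)
    · by_cases hjn : j = n - 1
      · exact absurd (hjn ▸ hl) h
      · refine hpair j (by omega) h fun hs => h ?_
        have := hgap (j - 1) hp (by rwa [show j - 1 + 2 = j + 1 by omega])
        rwa [show j - 1 + 1 = j by omega] at this
    · exact hpair (j - 1) (by omega) hp (by rwa [show j - 1 + 1 = j by omega])
  · exact ⟨f, .refl f, hl⟩

/-! ### Generation and the upper bound -/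

/-- The prefix reversals generate the monoid of partial automorphisms of the path. -/
theorem pAut_le_flips : (SimpleGraph.pathGraph n).PAut ≤ flips n := by
  suffices H : ∀ k, ∀ f ∈ (SimpleGraph.pathGraph n).PAut, n - size f = k → f ∈ flips n from
    fun f hf => H _ f hf rfl
  intro k
  induction k using Nat.strong_induction_on with
  | _ k ih =>
    intro f hf hk
    have ih' : ∀ g ∈ (SimpleGraph.pathGraph n).PAut, size f < size g → g ∈ flips n := by
      intro g hg hlt
      have := size_le g
      exact ih _ (by omega) g hg rfl
    have of_symm : ∀ f' : Fin n ≃. Fin n, size f' = size f → Extendable f'.symm →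
        f' ∈ flips n := fun f' hs h => by
      have := h.mem_flips (by rwa [size_symm, hs])
      simpa using symm_mem_flips this
    by_cases hfull : ∀ j < n, InDom f j
    · rcases eq_one_or_eq_flip hf hfull with rfl | rfl
      · exact one_mem _
      · exact flip_mem_flips le_rfl
    push Not at hfull
    obtain ⟨j, hj, hjd⟩ := hfull
    have hn : 0 < n := by omega
    by_cases hgd : ∀ i, InDom f i → InDom f (i + 2) → InDom f (i + 1)
    swap
    · push Not at hgd
      obtain ⟨i, h0, h2, h1⟩ := hgd
      exact (extendable_of_gap hf h0 h1 h2).mem_flips ih'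
    by_cases hgi : ∀ i, InIm f i → InIm f (i + 2) → InIm f (i + 1)
    swap
    · push Not at hgi
      obtain ⟨i, h0, h2, h1⟩ := hgi
      exact of_symm f rfl
        (extendable_of_gap (symm_mem_pAut hf) (inDom_symm.2 h0) (by rwa [inDom_symm])
          (inDom_symm.2 h2))
    obtain ⟨k', hk', hkim⟩ : ∃ k < n, ¬ InIm f k := by
      by_contra! hall
      have : n ≤ size f := by
        have hsub : (Finset.range n : Set ℕ) ⊆ {x | InDom f.symm x} := fun x hx =>
          inDom_symm.2 (hall x (by simpa using hx))
        have := Set.ncard_le_ncard hsub (finite_inDom _)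
        rw [Set.ncard_coe_finset, Finset.card_range] at this
        rwa [← size_symm]
      have hlt : size f < n := by
        have hsub : {x | InDom f x} ⊂ (Finset.range n : Set ℕ) :=
          ⟨fun x ⟨_, hy⟩ => by simpa using hy.lt_left, fun h => hjd (h (by simpa using hj))⟩
        have := Set.ncard_lt_ncard hsub (Finset.finite_toSet _)
        rwa [Set.ncard_coe_finset, Finset.card_range] at this
      omega
    -- Neither domain nor image has a gap of length one. Rearranging `f`, and then the inverse of
    -- the result, frees the last vertex on both sides.
    obtain ⟨f₁, hr₁, hl₁⟩ := exists_rearranges_not_inIm_last hk' hkim hgi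
    have hf₁ := hr₁.mem_pAut hf
    have hs₁ : size f₁ = size f := by simp only [size, hr₁.inDom_iff]
    obtain ⟨f₂, hr₂, hl₂⟩ := exists_rearranges_not_inIm_last (f := f₁.symm) hj
      (by rwa [inIm_symm, hr₁.inDom_iff])
      (by simpa only [inIm_symm, hr₁.inDom_iff] using hgd)
    have hs₂ : size f₂ = size f := by
      rw [← hs₁, ← size_symm f₁]
      simp only [size, hr₂.inDom_iff]
    have h₂ := (extendable_of_last (hr₂.mem_pAut (symm_mem_pAut hf₁)) hn
      (by rwa [hr₂.inDom_iff, inDom_symm]) hl₂).mem_flips (by rwa [hs₂])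
    refine hr₁.mem_flips ?_
    simpa using symm_mem_flips (hr₂.mem_flips h₂)

theorem minGenerators_le (I : Finset ℕ) (hI : ∀ i ∈ I, i ≤ n)
    (h : ∀ i ≤ n, flip n i ∈ Submonoid.closure (flip n '' I)) :
    Monoid.minGenerators (SimpleGraph.pathGraph n).PAut ≤ I.card := by
  set S : Set (SimpleGraph.pathGraph n).PAut := Subtype.val ⁻¹' (flip n '' I) with hS
  have himg : (SimpleGraph.pathGraph n).PAut.subtype '' S = flip n '' I := by
    rw [hS]
    refine Set.image_preimage_eq_of_subset ?_
    rintro _ ⟨i, hi, rfl⟩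
    exact ⟨⟨_, flip_mem_pAut (hI i hi)⟩, rfl⟩
  have htop : Submonoid.closure S = ⊤ := by
    rw [eq_top_iff]
    rintro ⟨x, hx⟩ -
    have h1 : flips n ≤ Submonoid.closure (flip n '' I) := by
      rw [flips, Submonoid.closure_le]
      rintro _ ⟨i, hi, rfl⟩
      exact h i hi
    have h2 := h1 (pAut_le_flips hx)
    rw [← himg, ← MonoidHom.map_mclosure] at h2
    obtain ⟨y, hy, hyx⟩ := h2
    obtain rfl : y = ⟨x, hx⟩ := Subtype.ext hyx
    exact hy
  calc Monoid.minGenerators (SimpleGraph.pathGraph n).PAut ≤ S.encard :=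
        iInf_le (fun T : {T : Set (SimpleGraph.pathGraph n).PAut // Submonoid.closure T = ⊤} =>
          (T : Set (SimpleGraph.pathGraph n).PAut).encard) ⟨S, htop⟩
    _ = (flip n '' I).encard := by
      rw [← himg]
      exact (Subtype.val_injective.encard_image S).symm
    _ ≤ (I : Set ℕ).encard := Set.encard_image_le _ _
    _ = I.card := Set.encard_coe_eq_coe_finsetCard I

/-- The reversal of a prefix with at most one vertex is the idempotent that removes one vertex,
and hence conjugate to the one that removes the mirrored vertex. -/
theorem flip_eq_of_le_one {i : ℕ} (hi : i < n) (h : i ≤ 1) :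
    flip n i = flip n n * (flip n (n - 1 - i) * flip n (n - 1 - i)) * flip n n := by
  refine ext_maps fun x y => ?_
  rw [maps_flip hi.le, maps_mul_flip le_rfl]
  simp only [maps_mul (f := flip n n), maps_flip_mul_flip (by omega : n - 1 - i ≤ n),
    maps_flip (le_refl n)]
  constructor
  · intro h'
    exact Or.inl ⟨by omega, n - 1 - x, by omega, by omega, by omega, by omega⟩
  · rintro (⟨h1, z, h2, h3, h4, h5⟩ | ⟨h1, z, h2, h3, h4, h5⟩) <;> omega

/-! ### Lower bound: maps missing at most one vertex -/

/-- All vertices except possibly `d` belong to the domain. -/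
def DefinedOff (f : Fin n ≃. Fin n) (d : ℕ) : Prop := ∀ x < n, x ≠ d → InDom f x

/-- The domain misses exactly one vertex, which is `m` or its mirror image. -/
def InClass (f : Fin n ≃. Fin n) (m : ℕ) : Prop :=
  ∃ d, (d = m ∨ d + m + 1 = n) ∧ ¬ InDom f d ∧ DefinedOff f d

theorem not_inDom_flip {i : ℕ} (hi : i ≤ n) : ¬ InDom (flip n i) i := by
  rintro ⟨y, h⟩
  rw [maps_flip hi] at h
  omega

theorem definedOff_flip {i : ℕ} (hi : i ≤ n) : DefinedOff (flip n i) i := by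
  intro x hx hne
  by_cases h : x < i
  · exact ⟨i - 1 - x, (maps_flip hi).2 (by omega)⟩
  · exact ⟨x, (maps_flip hi).2 (by omega)⟩

theorem inDom_of_inDom_mul {f g : Fin n ≃. Fin n} {x : ℕ} (h : InDom (f * g) x) : InDom f x := by
  obtain ⟨y, hy⟩ := h
  obtain ⟨z, hz, _⟩ := maps_mul.1 hy
  exact ⟨z, hz⟩

theorem inDom_right_of_maps {f g : Fin n ≃. Fin n} {x y : ℕ} (h : InDom (f * g) x)
    (hf : Maps f x y) : InDom g y := by
  obtain ⟨z, hz⟩ := h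
  obtain ⟨w, hw, hwz⟩ := maps_mul.1 hz
  rw [hf.right_unique hw]
  exact ⟨z, hwz⟩

/-- Induction over a generating set. -/
theorem pAut_induction {S : Set (Fin n ≃. Fin n)}
    (hS : Submonoid.closure S = (SimpleGraph.pathGraph n).PAut)
    {P : (Fin n ≃. Fin n) → Prop} (mem : ∀ f ∈ S, P f) (one : P 1)
    (mul : ∀ f ∈ (SimpleGraph.pathGraph n).PAut, ∀ g, P f → P g → P (f * g))
    {f : Fin n ≃. Fin n} (hf : f ∈ (SimpleGraph.pathGraph n).PAut) : P f := by
  rw [← hS] at hf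
  induction hf using Submonoid.closure_induction with
  | mem f hf => exact mem f hf
  | one => exact one
  | mul f g hf _ h h' => exact mul f (hS ▸ hf) g h h'

theorem mem_pAut_of_mem {S : Set (Fin n ≃. Fin n)}
    (hS : Submonoid.closure S = (SimpleGraph.pathGraph n).PAut) {f : Fin n ≃. Fin n}
    (hf : f ∈ S) : f ∈ (SimpleGraph.pathGraph n).PAut := by
  rw [← hS]
  exact Submonoid.subset_closure hf

/-- All factors of a total product are total. Without a total generator the identity would be the
only total product, but the reflection differs from it. -/
theorem exists_total_mem (hn : 2 ≤ n) {S : Set (Fin n ≃. Fin n)}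
    (hS : Submonoid.closure S = (SimpleGraph.pathGraph n).PAut) :
    ∃ t ∈ S, (∀ x < n, InDom t x) := by
  by_contra! hcon
  have key := pAut_induction hS (P := fun f => (∀ x < n, InDom f x) → f = 1)
    (fun f hf h => by
      obtain ⟨x, hx, h'⟩ := hcon f hf
      exact absurd (h x hx) h')
    (fun _ => rfl)
    (fun f _ g hf hg h => by
      obtain rfl := hf fun x hx => inDom_of_inDom_mul (h x hx)
      rw [one_mul] at h ⊢
      exact hg h)
    (flip_mem_pAut le_rfl) fun x hx => definedOff_flip le_rfl x hx hx.ne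
  have h1 : Maps (flip n n) 0 (n - 1) := (maps_flip le_rfl).2 (by omega)
  rw [key, maps_one] at h1
  omega

/-- In a product missing one vertex of the pair, a first factor that is total is the identity or the
reflection and preserves the pair, so the missing vertex is passed on to the next factor. Hence some
generator must miss it. -/
theorem exists_inClass_mem {m : ℕ} (hm : m < n) {S : Set (Fin n ≃. Fin n)}
    (hS : Submonoid.closure S = (SimpleGraph.pathGraph n).PAut) : ∃ t ∈ S, InClass t m := by
  by_contra! hcon
  refine not_inDom_flip hm.le (pAut_induction hS
    (P := fun f => ∀ d, (d = m ∨ d + m + 1 = n) → DefinedOff f d → InDom f d) ?_ ?_ ?_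
    (flip_mem_pAut hm.le) m (Or.inl rfl) (definedOff_flip hm.le))
  · intro f hf d hd h
    by_contra h'
    exact hcon f hf ⟨d, hd, h', h⟩
  · intro d hd _
    exact ⟨d, maps_one.2 ⟨by omega, rfl⟩⟩
  · intro f hf g h h' d hd hdef
    have hdf : DefinedOff f d := fun x hx hxd => inDom_of_inDom_mul (hdef x hx hxd)
    have htot : ∀ x < n, InDom f x := fun x hx => by
      by_cases hxd : x = d
      · rw [hxd]
        exact h d hd hdf
      · exact hdf x hx hxd
    rcases eq_one_or_eq_flip hf htot with rfl | rfl
    · rw [one_mul] at hdef ⊢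
      exact h' d hd hdef
    · have hmaps : ∀ x < n, Maps (flip n n) x (n - 1 - x) := fun x hx =>
        (maps_flip le_rfl).2 (by omega)
      obtain ⟨z, hz⟩ := h' (n - 1 - d) (by omega) fun x hx hxd => by
        have := inDom_right_of_maps (hdef (n - 1 - x) (by omega) (by omega))
          (hmaps (n - 1 - x) (by omega))
        rwa [show n - 1 - (n - 1 - x) = x by omega] at this
      exact ⟨z, maps_mul.2 ⟨_, hmaps d (by omega), hz⟩⟩

/-! ### Lower bound: reversing the two components -/

/-- The endpoints of the two components of the path with the vertex `m` (for `d = false`) or its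
mirror image (for `d = true`) removed. Here `l` tells whether the endpoint belongs to the component
beyond `m` or to the one before `m`, and `o` whether it is an endpoint of the whole path. -/
def endpoint (n m : ℕ) (d l o : Bool) : ℕ :=
  let x := match l, o with
    | false, true => 0
    | false, false => m - 1
    | true, true => n - 1
    | true, false => m + 1
  if d then n - 1 - x else x

/-- The vertex `m` or its mirror image. -/
def removed (n m : ℕ) (d : Bool) : ℕ := if d then n - 1 - m else m

/-- The action of `f` on the endpoints of components reverses those components `l` for which
`c l` holds. -/
def Reverses (f : Fin n ≃. Fin n) (m : ℕ) (d : Bool) (c : Bool → Bool) (d' : Bool) : Prop :=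
  ∀ l o, Maps f (endpoint n m d l o) (endpoint n m d' l (xor o (c l)))

/-- If `f` is defined off `m` or its mirror image, then it reverses the components according
to some `c` in `C`. -/
def ReversesIn (C : Set (Bool → Bool)) (m : ℕ) (f : Fin n ≃. Fin n) : Prop :=
  ∀ d, DefinedOff f (removed n m d) → ∃ d', ∃ c ∈ C, Reverses f m d c d' ∧
    ∀ y < n, y ≠ removed n m d' → ∃ x, x ≠ removed n m d ∧ Maps f x y

/-- Reversals add modulo 2 along a product. The image clause of `ReversesIn` ensures that the second
factor is again defined off `m` or its mirror image. -/
theorem reversesIn_mul {C : Set (Bool → Bool)} (hC : ∀ c ∈ C, ∀ c' ∈ C,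
    (fun l => xor (c l) (c' l)) ∈ C) {m : ℕ} {f g : Fin n ≃. Fin n} (hf : ReversesIn C m f)
    (hg : ReversesIn C m g) : ReversesIn C m (f * g) := by
  intro d hd
  obtain ⟨e, c, hc, hr, him⟩ := hf d fun x hx hxd => inDom_of_inDom_mul (hd x hx hxd)
  obtain ⟨e', c', hc', hr', him'⟩ := hg e fun y hy hye => by
    obtain ⟨x, hx, hxy⟩ := him y hy hye
    exact inDom_right_of_maps (hd x hxy.lt_left hx) hxy
  refine ⟨e', _, hC c hc c' hc', fun l o => ?_, fun z hz hze => ?_⟩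
  · rw [← Bool.xor_assoc]
    exact maps_mul.2 ⟨_, hr l o, hr' l _⟩
  · obtain ⟨y, hy, hyz⟩ := him' z hz hze
    obtain ⟨x, hx, hxy⟩ := him y hyz.lt_left hy
    exact ⟨x, hx, maps_mul.2 ⟨y, hxy, hyz⟩⟩

theorem endpoint_lt {m : ℕ} (h : 2 * m + 1 < n) (d l o : Bool) : endpoint n m d l o < n := by
  cases d <;> cases l <;> cases o <;> simp [endpoint] <;> omega

theorem reversesIn_one {C : Set (Bool → Bool)} (hC : (fun _ => false) ∈ C) {m : ℕ}
    (h : 2 * m + 1 < n) : ReversesIn C m (1 : Fin n ≃. Fin n) := by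
  intro d _
  refine ⟨d, _, hC, fun l o => ?_, fun y hy hyd => ⟨y, hyd, maps_one.2 ⟨hy, rfl⟩⟩⟩
  rw [Bool.xor_false, maps_one]
  exact ⟨endpoint_lt h d l o, rfl⟩

theorem reversesIn_reflection {C : Set (Bool → Bool)} (hC : (fun _ => false) ∈ C) {m : ℕ}
    (h : 2 * m + 1 < n) : ReversesIn C m (flip n n) := by
  intro d _
  refine ⟨!d, _, hC, fun l o => ?_, fun y hy hyd => ⟨n - 1 - y, ?_, ?_⟩⟩
  · rw [Bool.xor_false, maps_flip le_rfl]
    cases d <;> cases l <;> cases o <;> simp [endpoint] <;> omega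
  · cases d <;> simp [removed] at hyd ⊢ <;> omega
  · rw [maps_flip le_rfl]
    omega

/-- `flip n m` reverses the component before `m`, labelled `false`. The prefix of length `n - 1 - m`
is the mirror image of the component beyond `m`, labelled `true`. -/
theorem reversesIn_flip {C : Set (Bool → Bool)} (hC : (fun _ => false) ∈ C) {m i : ℕ}
    (hm : 1 ≤ m) (h : 2 * m + 1 < n) (hi : i ≤ n) (h1 : i = m → (fun l => !l) ∈ C)
    (h2 : i = n - 1 - m → (fun l => l) ∈ C) : ReversesIn C m (flip n i) := by
  rcases hi.eq_or_lt with rfl | hin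
  · exact reversesIn_reflection hC h
  intro d hd
  obtain rfl : i = removed n m d := by
    by_contra hne
    exact not_inDom_flip hi (hd i hin hne)
  have him : ∀ y < n, y ≠ removed n m d → ∃ x, x ≠ removed n m d ∧
      Maps (flip n (removed n m d)) x y := by
    intro y hy hyd
    by_cases hlt : y < removed n m d
    · exact ⟨removed n m d - 1 - y, by omega, (maps_flip hi).2 (by omega)⟩
    · exact ⟨y, hyd, (maps_flip hi).2 (by omega)⟩
  cases d
  · refine ⟨false, _, h1 rfl, fun l o => ?_, him⟩
    rw [maps_flip hi]
    cases l <;> cases o <;> simp [endpoint, removed] <;> omega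
  · refine ⟨true, _, h2 rfl, fun l o => ?_, him⟩
    rw [maps_flip hi]
    cases l <;> cases o <;> simp [endpoint, removed] <;> omega

/-- Generation by prefix reversals reduces the claim to these and to products. -/
theorem reversesIn_univ {m : ℕ} (hm : 1 ≤ m) (h : 2 * m + 1 < n) {f : Fin n ≃. Fin n}
    (hf : f ∈ (SimpleGraph.pathGraph n).PAut) : ReversesIn Set.univ m f := by
  replace hf := pAut_le_flips hf
  rw [flips] at hf
  induction hf using Submonoid.closure_induction with
  | mem f hf =>
    obtain ⟨i, hi, rfl⟩ := hf
    exact reversesIn_flip (Set.mem_univ _) hm h hi (fun _ => Set.mem_univ _) fun _ => Set.mem_univ _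
  | one => exact reversesIn_one (Set.mem_univ _) h
  | mul f g _ _ ihf ihg => exact reversesIn_mul (fun _ _ _ _ => Set.mem_univ _) ihf ihg

theorem of_reversesIn_flip {C : Set (Bool → Bool)} {m : ℕ} (hm : 2 ≤ m) (h : 2 * m + 1 < n)
    (d : Bool) (hr : ReversesIn C m (flip n (removed n m d))) : (fun l => xor l (!d)) ∈ C := by
  have hlt : removed n m d < n := by
    cases d <;> simp [removed] <;> omega
  obtain ⟨d', c, hc, hrev, him⟩ := hr d (definedOff_flip hlt.le)
  have hdd : removed n m d' = removed n m d := by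
    by_contra hne
    obtain ⟨x, -, hx⟩ := him _ hlt (Ne.symm hne)
    rw [maps_flip hlt.le] at hx
    omega
  -- The vertices `m` and `n - 1 - m` differ because `2 * m + 1 < n`.
  obtain rfl : d' = d := by
    cases d <;> cases d' <;> simp [removed] at hdd ⊢ <;> omega
  convert hc using 1
  funext l
  -- The outer endpoint alone determines `c l`: as `2 ≤ m`, the two endpoints of each component are
  -- distinct.
  have := (maps_flip hlt.le).1 (hrev l true)
  clear hrev
  generalize c l = b at this
  cases d' <;> cases l <;> cases b <;> simp [removed, endpoint] at this ⊢ <;> omega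

theorem exists_two_inClass_mem {m : ℕ} (hm : 2 ≤ m) (h : 2 * m + 1 < n)
    {S : Set (Fin n ≃. Fin n)} (hS : Submonoid.closure S = (SimpleGraph.pathGraph n).PAut) :
    ∃ s ∈ S, ∃ t ∈ S, InClass s m ∧ InClass t m ∧ s ≠ t := by
  obtain ⟨s, hs, hsm⟩ := exists_inClass_mem (by omega : m < n) hS
  by_contra! hcon
  have huniq : ∀ t ∈ S, InClass t m → t = s := fun t ht htm => (hcon s hs t ht hsm htm).symm
  obtain ⟨e, he, hse, hdef⟩ := hsm
  have hrem : ∀ d, removed n m d = m ∨ removed n m d + m + 1 = n := by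
    rintro (_ | _)
    · exact Or.inl rfl
    · simp only [removed, if_true]
      omega
  obtain ⟨d, rfl⟩ : ∃ d, e = removed n m d := by
    rcases he with rfl | he
    · exact ⟨false, rfl⟩
    · exact ⟨true, by simp [removed]; omega⟩
  obtain ⟨d', c, -, hrev, him⟩ := reversesIn_univ (by omega) h (mem_pAut_of_mem hS hs) d hdef
  -- With `s` the only generator of its class, products realise only the trivial reversal and that
  -- of `s`.
  set C : Set (Bool → Bool) := {fun _ => false, c} with hCdef
  have hC0 : (fun _ => false) ∈ C := Set.mem_insert _ _
  have hC : ∀ a ∈ C, ∀ b ∈ C, (fun l => xor (a l) (b l)) ∈ C := by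
    rintro a (rfl | rfl) b (rfl | rfl) <;> simp [hCdef]
  have key : ∀ f ∈ (SimpleGraph.pathGraph n).PAut, ReversesIn C m f := by
    intro f hf
    refine pAut_induction hS (P := ReversesIn C m) ?_ (reversesIn_one hC0 h)
      (fun f _ g hf hg => reversesIn_mul hC hf hg) hf
    intro t ht k hk
    by_cases htk : InDom t (removed n m k)
    · have htot : ∀ x < n, InDom t x := fun x hx => by
        by_cases hxk : x = removed n m k
        · rwa [hxk]
        · exact hk x hx hxk
      rcases eq_one_or_eq_flip (mem_pAut_of_mem hS ht) htot with rfl | rfl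
      · exact reversesIn_one hC0 h k hk
      · exact reversesIn_reflection hC0 h k hk
    · obtain rfl := huniq t ht ⟨_, hrem k, htk, hk⟩
      have hkd : removed n m k = removed n m d := by
        by_contra hne
        exact htk (hdef _ (by have := hrem k; omega) hne)
      rw [hkd]
      obtain rfl : k = d := by
        cases d <;> cases k <;> simp [removed] at hkd ⊢ <;> omega
      exact ⟨d', c, Set.mem_insert_of_mem _ rfl, hrev, him⟩
  have h1 := of_reversesIn_flip hm h false (key _ (flip_mem_pAut (by simp [removed]; omega)))
  have h2 := of_reversesIn_flip hm h true (key _ (flip_mem_pAut (by simp [removed]; omega)))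
  -- `flip n m` and `flip n (n - 1 - m)` put two distinct nontrivial functions into `C`.
  rcases h1 with h1 | h1
  · simpa using congrFun h1 false
  rcases h2 with h2 | h2
  · simpa using congrFun h2 true
  · rw [Set.mem_singleton_iff] at h2
    simpa using congrFun (h1.trans h2.symm) true

theorem inClass_mirror {f : Fin n ≃. Fin n} {m : ℕ} (hm : m < n) (h : InClass f (n - 1 - m)) :
    InClass f m := by
  obtain ⟨d, hd, h⟩ := h
  exact ⟨d, by omega, h⟩

theorem eq_or_of_inClass {f : Fin n ≃. Fin n} {i k : ℕ} (hi : i < n) (h : InClass f i)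
    (h' : InClass f k) : i = k ∨ i + k + 1 = n := by
  obtain ⟨d, hd, h1, h2⟩ := h
  obtain ⟨d', hd', h1', h2'⟩ := h'
  have : d = d' := by
    by_contra hne
    exact h1 (h2' d (by omega) hne)
  omega

/-! ### Counting generators -/

/-- Each index in `I` gets its own generator, and a total one is added. Both members of a mirror
pair may be used only where the pair is known to need two generators. -/
theorem card_lt_encard (hn : 2 ≤ n) {S : Set (Fin n ≃. Fin n)}
    (hS : Submonoid.closure S = (SimpleGraph.pathGraph n).PAut) (I : Finset ℕ)
    (hI : ∀ i ∈ I, i < n) (hI' : ∀ i ∈ I, 2 * i + 1 < n → n - 1 - i ∈ I → 2 ≤ i) :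
    ((I.card + 1 : ℕ) : ℕ∞) ≤ S.encard := by
  obtain ⟨t, htS, ht⟩ := exists_total_mem hn hS
  have hpq : ∀ m < n, ∃ p ∈ S, ∃ q ∈ S, InClass p m ∧ InClass q m ∧
      (2 ≤ m → 2 * m + 1 < n → p ≠ q) := by
    intro m hm
    by_cases h : 2 ≤ m ∧ 2 * m + 1 < n
    · obtain ⟨p, hp, q, hq, h1, h2, h3⟩ := exists_two_inClass_mem h.1 h.2 hS
      exact ⟨p, hp, q, hq, h1, h2, fun _ _ => h3⟩
    · obtain ⟨p, hp, h1⟩ := exists_inClass_mem hm hS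
      exact ⟨p, hp, p, hp, h1, h1, fun h2 h3 => absurd ⟨h2, h3⟩ h⟩
  choose! p hp q hq hcp hcq hne using hpq
  -- The smaller index of a mirror pair takes `p`, the larger takes `q` of the smaller.
  let s : ℕ → Fin n ≃. Fin n := fun i => if 2 * i + 1 < n then p i else q (n - 1 - i)
  have hs : ∀ i < n, s i ∈ S ∧ InClass (s i) i := by
    intro i hi
    by_cases h : 2 * i + 1 < n
    · simp only [s, if_pos h]
      exact ⟨hp i hi, hcp i hi⟩
    · simp only [s, if_neg h]
      exact ⟨hq _ (by omega), inClass_mirror hi (hcq _ (by omega))⟩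
  have hswap : ∀ i ∈ I, ∀ k ∈ I, 2 * i + 1 < n → i + k + 1 = n → s i ≠ s k := by
    intro i hi k hk h hik
    have h2 := hI' i hi h (by rwa [show n - 1 - i = k by omega])
    simp only [s, if_pos h, if_neg (show ¬ 2 * k + 1 < n by omega)]
    rw [show n - 1 - k = i by omega]
    exact hne i (by omega) h2 h
  have hinj : Set.InjOn s I := by
    intro i hi k hk e
    have h2 := (hs k (hI k hk)).2
    rw [← e] at h2
    rcases eq_or_of_inClass (hI i hi) (hs i (hI i hi)).2 h2 with h | h
    · exact h
    · rcases lt_trichotomy (2 * i + 1) n with h3 | h3 | h3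
      · exact absurd e (hswap i hi k hk h3 h)
      · omega
      · exact absurd e.symm (hswap k hk i hi (by omega) (by omega))
  have hnot : t ∉ s '' I := by
    rintro ⟨i, hi, rfl⟩
    obtain ⟨d, hd, h1, _⟩ := (hs i (hI i hi)).2
    exact h1 (ht d (by have := hI i hi; omega))
  have hsub : insert t (s '' I) ⊆ S := by
    rw [Set.insert_subset_iff]
    refine ⟨htS, ?_⟩
    rintro _ ⟨i, hi, rfl⟩
    exact (hs i (hI i hi)).1
  calc ((I.card + 1 : ℕ) : ℕ∞) = (insert t (s '' I)).encard := by
        rw [Set.encard_insert_of_notMem hnot, hinj.encard_image, Set.encard_coe_eq_coe_finsetCard]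
        push_cast
        rfl
    _ ≤ S.encard := Set.encard_le_encard hsub

theorem le_minGenerators (hn : 2 ≤ n) (I : Finset ℕ)
    (hI : ∀ i ∈ I, i < n) (hI' : ∀ i ∈ I, 2 * i + 1 < n → n - 1 - i ∈ I → 2 ≤ i) :
    ((I.card + 1 : ℕ) : ℕ∞) ≤ Monoid.minGenerators (SimpleGraph.pathGraph n).PAut := by
  refine le_iInf fun ⟨S, hS⟩ => ?_
  have h := card_lt_encard hn (S := (SimpleGraph.pathGraph n).PAut.subtype '' S) (by
    rw [← MonoidHom.map_mclosure, hS, ← MonoidHom.mrange_eq_map, Submonoid.mrange_subtype]) I hI hI'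
  exact h.trans (Set.encard_image_le _ _)

end PathPAut

theorem theorem3 :
    Monoid.minGenerators (SimpleGraph.pathGraph 3).PAut = 3 ∧
      ∀ n : ℕ, 4 ≤ n →
        Monoid.minGenerators (SimpleGraph.pathGraph n).PAut = ((n - 1 : ℕ) : ℕ∞) := by
  have of_short : ∀ {n i : ℕ} {J : Finset ℕ}, i < n → i ≤ 1 → n ∈ J → n - 1 - i ∈ J →
      PathPAut.flip n i ∈ Submonoid.closure (PathPAut.flip n '' J) := by
    intro n i J hi h1 hn hni
    have h : ∀ j ∈ J, PathPAut.flip n j ∈ Submonoid.closure (PathPAut.flip n '' J) :=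
      fun j hj => Submonoid.subset_closure ⟨j, hj, rfl⟩
    rw [PathPAut.flip_eq_of_le_one hi h1]
    exact mul_mem (mul_mem (h _ hn) (mul_mem (h _ hni) (h _ hni))) (h _ hn)
  constructor
  -- For `n = 3` the indices 1 and 2 represent the classes {1} and {0, 2}.
  · refine le_antisymm (PathPAut.minGenerators_le (Finset.Icc 1 3) (by simp) ?_)
      (PathPAut.le_minGenerators (by norm_num) {1, 2} (by simp) (by simp))
    intro i hi
    rcases Nat.eq_zero_or_pos i with rfl | hpos
    · exact of_short (by omega) (by omega) (by simp) (by simp)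
    · exact Submonoid.subset_closure ⟨i, by simp; omega, rfl⟩
  · intro n hn
    -- In `Finset.Ico 2 n` the indices `n - 1` and `n - 2` stand alone for the pairs of 0 and 1;
    -- every other index occurs with its mirror image.
    refine le_antisymm ((PathPAut.minGenerators_le (Finset.Icc 2 n) (by simp) ?_).trans ?_)
      (le_trans ?_ (PathPAut.le_minGenerators (by omega) (Finset.Ico 2 n) (by simp) ?_))
    · intro i hi
      rcases Nat.lt_or_ge i 2 with h | h
      · exact of_short (by omega) (by omega) (by simp; omega) (by simp; omega)
      · exact Submonoid.subset_closure ⟨i, by simp; omega, rfl⟩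
    · simp
    · simp only [Nat.card_Ico, Nat.cast_le]
      omega
    · intro i hi _ _
      exact (Finset.mem_Ico.1 hi).1
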